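/- Consider directed graphs $G=(V,E)$, loops allowed, with $V=\{0,\dots,n-1\}$, together with a start vertex $s\in V$ and a set $T\subseteq V$. The problem $\mathrm{Safe}(T)$ (safety) asks whether some infinite path from $s$ visits only vertices of $T$; the problem $\mathrm{coBuchi}(T)$ (co-liveness) asks whether some infinite path from $s$ visits only vertices of $T$ from some point on. The diameter $D$ of a graph is its largest finite distance; for a strongly connected component $C$ of $G$ (trivial components included), $D_C$ is the diameter of the subgraph induced by $C$. A *symbolic algorithm* is given $n$, $s$ and $T$. It accesses the edges only through the one-step operations $\mathrm{Pre}(S)=\{v\mid \exists u\in S:(v,u)\in E\}$ and $\mathrm{Post}(S)=\{v\mid \exists u\in S:(u,v)\in E\}$ for sets $S\subseteq V$ of its choice. Basic set operations and all non-symbolic computation and storage are unrestricted and not counted. It is deterministic, or probabilistic. It solves a problem on a class of graphs if, on every instance whose graph is in the class, it halts with the correct answer (deterministic case), respectively does so with probability at least $1-\delta$ (probabilistic case, with error bound $\delta$). Its cost on an instance is the number of one-step operations that it performs on it (deterministic case), respectively the expected number (probabilistic case). **Theorem 3.5.** Let the problem be $\mathrm{Safe}(T)$ or $\mathrm{coBuchi}(T)$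 and let $0\le\delta<1/2$. The following lower bounds hold both for deterministic symbolic algorithms and for probabilistic symbolic algorithms with error bound $\delta$. 1. ($\Omega(n)$, even on constant-diameter graphs.) There are $c>0$ and $N$ such that for every $n\ge N$, every algorithm that solves the problem on the graphs of diameter $1$ has cost at least $c\,n$ on some instance with $n$ vertices and diameter $1$. 2. ($\Omega(|T|)$, even on constant-diameter graphs.) There are $c>0$ and $N$ such that for every $t\ge N$, every algorithm that solves the problem on the graphs of diameter $1$ has cost at least $c\,t$ on some instance with $|T|=t$ and diameter $1$. 3. ($\omega(\sum_C(D_C+1))$, even on strongly connected graphs of diameter $2$.) For every $K\in\mathbb N$ there is $N$ such that for every $n\ge N$, every algorithm that solves the problem on the strongly connected graphs of diameter $2$ has cost greater than $K\cdot\sum_{C}(D_C+1)$ on some instance with $n$ vertices whose graph $G$ is strongly connected and of diameter $2$, where $C$ ranges over the strongly connected components of $G$. The constants $c$ and $N$ depend only on $\delta$ (and, in part 3, $N$ also on $K$), not on the algorithm. -/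

import Mathlib

open MeasureTheory Filter
open scoped ENNReal

noncomputable section

namespace SymbolicGraph

/-! Directed graphs (loops are allowed): `Digraph V` from Mathlib. -/

section Graphs

variable {V : Type*}

/-- The predecessors of `S`: vertices with an edge to some vertex of `S`. -/
def pre (G : Digraph V) (S : Set V) : Set V := {v | ∃ s ∈ S, G.Adj v s}

/-- The successors of `S`: vertices with an edge from some vertex of `S`. -/
def post (G : Digraph V) (S : Set V) : Set V := {v | ∃ s ∈ S, G.Adj s v}

/-- There is a directed walk with exactly `k` edges from `u` to `v`. -/
def HasWalk (G : Digraph V) (u v : V) (k : ℕ) : Prop :=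
  ∃ p : ℕ → V, p 0 = u ∧ p k = v ∧ ∀ i < k, G.Adj (p i) (p (i + 1))

/-- `v` is reachable from `u` (by a possibly empty walk). -/
def Reachable (G : Digraph V) (u v : V) : Prop := ∃ k, HasWalk G u v k

/-- The distance from `u` to `v`, which is `⊤` if `v` is not reachable from `u`. -/
def dist (G : Digraph V) (u v : V) : ℕ∞ := ⨅ (k : ℕ) (_ : HasWalk G u v k), (k : ℕ∞)

/-- The diameter: the largest finite distance in the graph. -/
def diameter (G : Digraph V) : ℕ∞ := ⨆ (u : V) (v : V) (_ : dist G u v ≠ ⊤), dist G u v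

/-- Every vertex is reachable from every vertex. -/
def StronglyConnected (G : Digraph V) : Prop := ∀ u v, Reachable G u v

/-- The strongly connected component of `u`. -/
def sccOf (G : Digraph V) (u : V) : Set V := {v | Reachable G u v ∧ Reachable G v u}

/-- The set of all strongly connected components (trivial ones included). -/
def sccs (G : Digraph V) : Set (Set V) := Set.range (sccOf G)

/-- The subgraph induced by the vertex set `C`. -/
def induced (G : Digraph V) (C : Set V) : Digraph C where
  Adj a b := G.Adj a b

/-- The sum over all strongly connected components `C` of `D_C + 1`, where `D_C` is the diameter
of `C`. -/
def sumSccDiameters [Finite V] (G : Digraph V) : ℕ∞ :=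
  ∑ C ∈ (Set.toFinite (sccs G)).toFinset, (diameter (induced G C) + 1)

end Graphs

/-- An input: a graph with `n` vertices, a start vertex, and a set of target (safe) vertices. -/
structure Instance (n : ℕ) where
  graph : Digraph (Fin n)
  start : Fin n
  target : Set (Fin n)

/-- `p` is an infinite path of the graph from the start vertex. -/
def Instance.IsInfinitePath {n : ℕ} (I : Instance n) (p : ℕ → Fin n) : Prop :=
  p 0 = I.start ∧ ∀ i, I.graph.Adj (p i) (p (i + 1))

/-- The two objectives: safety, and co-liveness (co-Büchi). -/
inductive Objective
  | safety
  | coLiveness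

/-- The requirement that an objective puts on an infinite path: `Safe(T)` asks it to visit only
vertices of `T`, `coBuchi(T)` asks it to visit only vertices of `T` from some point on. -/
def Objective.SatisfiedBy {V : Type*} (T : Set V) (p : ℕ → V) : Objective → Prop
  | safety => ∀ i, p i ∈ T
  | coLiveness => ∀ᶠ i in atTop, p i ∈ T

/-- The question to be decided: some infinite path from the start vertex satisfies the
objective. -/
def Objective.Holds (obj : Objective) {n : ℕ} (I : Instance n) : Prop :=
  ∃ p, I.IsInfinitePath p ∧ obj.SatisfiedBy I.target p

/-- The symbolic operations: the basic set operations, and the one-step operations `Pre` and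
`Post`, which are the only ones that access the edges of the graph. -/
inductive SymbolicOp (V : Type*)
  | union (X Y : Set V)
  | inter (X Y : Set V)
  | diff (X Y : Set V)
  | compl (X : Set V)
  | pre (X : Set V)
  | post (X : Set V)

/-- The set returned by a symbolic operation on the graph `G`. -/
def SymbolicOp.result {V : Type*} (G : Digraph V) : SymbolicOp V → Set V
  | union X Y => X ∪ Y
  | inter X Y => X ∩ Y
  | diff X Y => X \ Y
  | compl X => Xᶜ
  | pre X => SymbolicGraph.pre G X
  | post X => SymbolicGraph.post G X

/-- The one-step operations are `Pre` and `Post`. -/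
def SymbolicOp.IsOneStep {V : Type*} : SymbolicOp V → Prop
  | pre _ => True
  | post _ => True
  | _ => False

/-- What an algorithm does next: a symbolic operation, or halting with an answer. -/
inductive Action (V : Type*)
  | perform (op : SymbolicOp V)
  | answer (b : Bool)

/-- A deterministic symbolic algorithm for decision problems on graphs with a start vertex `s` and
a target set `T`. The input consists of the vertex set `Fin n`, of `s` and of `T`; the edges are
accessible only through symbolic operations. The next action is an arbitrary function of the input
and of the list of all sets that the previous symbolic operations returned. So all non-symbolic
computation (tests such as `⊆` and `=` between sets included) is free and unrestricted, and any
number of sets can be stored. -/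
structure SymbolicAlgorithm where
  next : (n : ℕ) → (s : Fin n) → (T : Set (Fin n)) → List (Set (Fin n)) → Action (Fin n)

namespace SymbolicAlgorithm

variable (A : SymbolicAlgorithm) {n : ℕ} (I : Instance n)

/-- The action chosen on the instance `I` after the symbolic operations so far have returned the
sets in `h`. -/
def action (h : List (Set (Fin n))) : Action (Fin n) := A.next n I.start I.target h

/-- The results of the first `i` symbolic operations of the run on `I`, in order (of all of them,
if the run halts after fewer than `i` operations). -/
def history : ℕ → List (Set (Fin n))
  | 0 => []
  | i + 1 =>
    match A.action I (history i) with
    | .perform op => history i ++ [op.result I.graph]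
    | .answer _ => history i

/-- The run on `I` halts with the answer `b`. -/
def Outputs (b : Bool) : Prop := ∃ i, A.action I (A.history I i) = .answer b

/-- The run on `I` halts with the correct answer for the objective. -/
def Correct (obj : Objective) : Prop := ∃ b, A.Outputs I b ∧ (b = true ↔ obj.Holds I)

/-- The number of symbolic one-step operations in the run on `I`. -/
def numOneStep : ℕ∞ :=
  {i : ℕ | ∃ op : SymbolicOp (Fin n),
    A.action I (A.history I i) = .perform op ∧ op.IsOneStep}.encard

/-- The algorithm solves the objective on all graphs of the class `P`. -/
def Solves (obj : Objective) (P : (n : ℕ) → Digraph (Fin n) → Prop) : Prop :=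
  ∀ (n : ℕ) (I : Instance n), P n I.graph → A.Correct I obj

end SymbolicAlgorithm

/-- A probabilistic symbolic algorithm: a deterministic one for each outcome `ω` of its random
choices, where each choice of the next action is an event. -/
structure ProbabilisticAlgorithm (Ω : Type*) [MeasurableSpace Ω] where
  run : Ω → SymbolicAlgorithm
  measurable_next : ∀ (n : ℕ) (s : Fin n) (T : Set (Fin n)) (h : List (Set (Fin n)))
    (a : Action (Fin n)), MeasurableSet {ω | (run ω).next n s T h = a}

namespace ProbabilisticAlgorithm

variable {Ω : Type*} [MeasurableSpace Ω] (μ : Measure Ω) (A : ProbabilisticAlgorithm Ω)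

/-- The algorithm solves the objective on all graphs of the class `P` with error probability at
most `δ`: on every such instance it is correct with probability at least `1 - δ`. -/
def Solves (obj : Objective) (δ : ℝ) (P : (n : ℕ) → Digraph (Fin n) → Prop) : Prop :=
  ∀ (n : ℕ) (I : Instance n), P n I.graph →
    ENNReal.ofReal (1 - δ) ≤ μ {ω | (A.run ω).Correct I obj}

/-- The expected number of symbolic one-step operations on the instance `I`. -/
def expectedOneStep {n : ℕ} (I : Instance n) : ℝ≥0∞ :=
  ∫⁻ ω, (((A.run ω).numOneStep I : ℕ∞) : ℝ≥0∞) ∂μ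

end ProbabilisticAlgorithm

end SymbolicGraph

end

namespace SymbolicGraph

/-! ### Walks, distances and diameters. -/

section Distances

variable {V : Type*} {G : Digraph V} {u v : V} {k : ℕ}

/-! This is an adversary argument. In the strict linear order on the vertices every walk is finite,
so both objectives fail; adding one loop at `i` creates the path `0, i, i, ...` and both hold. The
loop changes `Pre S` only if `i` is the maximum of `S`, and `Post S` only if `i` is the minimum
(`isGreatest_of_pre_ne`, `isLeast_of_post_ne`). So each operation separates at most one of the `n`
looped graphs from the loopless one.

A correct deterministic run on the loopless graph must separate all of them, hence makes at least
`n` one-step operations. A probabilistic algorithm is correct on both the loopless graph and the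
graph with loop `i` with probability at least `1 - 2δ`; summing over `i` bounds the expected cost
(`card_mul_le_expectedOneStep`).

The order has diameter 1, and all vertices may be targets, which gives parts 1 and 2. For part 3 the
last vertex becomes a non-target hub with edges to all vertices: the graph is then strongly
connected of diameter 2, its component sum is at most 3, and the hub is useless for either
objective. -/

theorem HasWalk.dist_le (h : HasWalk G u v k) : dist G u v ≤ k :=
  iInf₂_le k h

theorem HasWalk.refl (G : Digraph V) (u : V) : HasWalk G u u 0 :=
  ⟨fun _ => u, rfl, rfl, fun _ h => absurd h (Nat.not_lt_zero _)⟩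

theorem HasWalk.of_adj (h : G.Adj u v) : HasWalk G u v 1 := by
  refine ⟨fun i => if i = 0 then u else v, rfl, rfl, fun i hi => ?_⟩
  obtain rfl : i = 0 := by omega
  simpa using h

theorem HasWalk.of_adj_adj {w : V} (h : G.Adj u w) (h' : G.Adj w v) : HasWalk G u v 2 := by
  refine ⟨fun i => if i = 0 then u else if i = 1 then w else v, rfl, rfl, fun i hi => ?_⟩
  obtain rfl | rfl : i = 0 ∨ i = 1 := by omega
  · simpa using h
  · simpa using h'

theorem reachable_of_dist_ne_top (h : dist G u v ≠ ⊤) : Reachable G u v := by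
  by_contra hr
  refine h ?_
  simp only [dist, iInf_eq_top]
  exact fun k hk => absurd ⟨k, hk⟩ hr

theorem le_diameter {d : ℕ∞} (hr : HasWalk G u v k) (h : ∀ j, HasWalk G u v j → d ≤ j) :
    d ≤ diameter G := by
  have hne : dist G u v ≠ ⊤ := ne_top_of_le_ne_top (ENat.natCast_ne_top k) hr.dist_le
  exact (le_iInf₂ h).trans (le_iSup_of_le u (le_iSup_of_le v (le_iSup_of_le hne le_rfl)))

theorem diameter_le {d : ℕ∞} (h : ∀ u v, Reachable G u v → dist G u v ≤ d) : diameter G ≤ d :=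
  iSup_le fun u => iSup_le fun v => iSup_le fun hne => h u v (reachable_of_dist_ne_top hne)

/-- A vertex with edges from and to all vertices bounds the diameter by two. -/
theorem diameter_le_two_of_hub (w : V) (hin : ∀ u, G.Adj u w) (hout : ∀ v, G.Adj w v) :
    diameter G ≤ 2 :=
  diameter_le fun u v _ => (HasWalk.of_adj_adj (hin u) (hout v)).dist_le

theorem stronglyConnected_of_hub (w : V) (hin : ∀ u, G.Adj u w) (hout : ∀ v, G.Adj w v) :
    StronglyConnected G :=
  fun u v => ⟨2, HasWalk.of_adj_adj (hin u) (hout v)⟩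

/-- The hub leaves a single component, so the sum is one term, at most `2 + 1`. -/
theorem sumSccDiameters_le_three_of_hub [Finite V] (w : V) (hin : ∀ u, G.Adj u w)
    (hout : ∀ v, G.Adj w v) : sumSccDiameters G ≤ 3 := by
  have hG := stronglyConnected_of_hub w hin hout
  have hscc : sccs G = {Set.univ} := by
    have : Nonempty V := ⟨w⟩
    have h : sccOf G = fun _ => Set.univ := by
      funext u
      exact Set.eq_univ_of_forall fun v => ⟨hG u v, hG v u⟩
    rw [sccs, h, Set.range_const]
  have hfin : (Set.toFinite (sccs G)).toFinset = {Set.univ} := by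
    ext C
    simp [hscc]
  rw [sumSccDiameters, hfin, Finset.sum_singleton]
  have hd : diameter (induced G Set.univ) ≤ 2 :=
    diameter_le_two_of_hub ⟨w, trivial⟩ (fun u => hin u) (fun v => hout v)
  calc diameter (induced G Set.univ) + 1 ≤ 2 + 1 := by gcongr
    _ = 3 := by norm_num

end Distances

/-! ### Runs of deterministic algorithms. -/

namespace SymbolicAlgorithm

variable (A : SymbolicAlgorithm) {n : ℕ} (I : Instance n)

theorem history_succ (k : ℕ) : A.history I (k + 1) =
    match A.action I (A.history I k) with
    | .perform op => A.history I k ++ [op.result I.graph]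
    | .answer _ => A.history I k := rfl

variable {A I}

theorem history_eq_of_answer {k : ℕ} {b : Bool} (h : A.action I (A.history I k) = .answer b)
    (j : ℕ) : A.history I (k + j) = A.history I k := by
  induction j with
  | zero => rfl
  | succ j ih => rw [← Nat.add_assoc, history_succ, ih, h]

theorem Outputs.unique {b b' : Bool} (h : A.Outputs I b) (h' : A.Outputs I b') : b = b' := by
  obtain ⟨k, hk⟩ := h
  obtain ⟨k', hk'⟩ := h'
  have h₁ := history_eq_of_answer hk k'
  have h₂ := history_eq_of_answer hk' k
  rw [Nat.add_comm, h₁] at h₂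
  rw [← h₂, hk] at hk'
  exact Action.answer.inj hk'

/-- Two runs coincide if all operations of the first return the same sets on both graphs. -/
theorem history_congr {J : Instance n} (hs : J.start = I.start) (hT : J.target = I.target)
    (h : ∀ k op, A.action I (A.history I k) = .perform op →
      op.result I.graph = op.result J.graph) (k : ℕ) : A.history J k = A.history I k := by
  induction k with
  | zero => rfl
  | succ k ih =>
    have hact : A.action J (A.history I k) = A.action I (A.history I k) := by
      simp only [action, hs, hT]
    rw [history_succ, history_succ, ih, hact]
    cases hop : A.action I (A.history I k) with
    | perform op => simp only [h k op hop]
    | answer b => rfl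

theorem outputs_congr {J : Instance n} (hs : J.start = I.start) (hT : J.target = I.target)
    (h : ∀ k op, A.action I (A.history I k) = .perform op →
      op.result I.graph = op.result J.graph) (b : Bool) : A.Outputs J b ↔ A.Outputs I b := by
  simp only [Outputs, history_congr hs hT h, action, hs, hT]

end SymbolicAlgorithm

/-! ### Measurability of the events of a probabilistic run. -/

section Measurability

open SymbolicAlgorithm

/-- Measurability is assumed only for single actions; countability extends it to every property of
the next action. -/
instance Action.countable (V : Type*) [Finite V] : Countable (Action V) := by
  let f : Action V → ℕ × Set V × Set V := fun
    | .perform (.union X Y) => (0, X, Y)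
    | .perform (.inter X Y) => (1, X, Y)
    | .perform (.diff X Y) => (2, X, Y)
    | .perform (.compl X) => (3, X, X)
    | .perform (.pre X) => (4, X, X)
    | .perform (.post X) => (5, X, X)
    | .answer true => (6, ∅, ∅)
    | .answer false => (7, ∅, ∅)
  refine Function.Injective.countable (f := f) fun a b h => ?_
  rcases a with (_ | _ | _ | _ | _ | _) | (_ | _) <;>
    rcases b with (_ | _ | _ | _ | _ | _) | (_ | _) <;> simp_all [f]

variable {Ω : Type*} [MeasurableSpace Ω] (A : ProbabilisticAlgorithm Ω) {n : ℕ} (I : Instance n)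

theorem ProbabilisticAlgorithm.measurableSet_action (h : List (Set (Fin n)))
    (P : Action (Fin n) → Prop) : MeasurableSet {ω | P ((A.run ω).action I h)} := by
  have : {ω | P ((A.run ω).action I h)} =
      ⋃ a ∈ {a | P a}, {ω | (A.run ω).next n I.start I.target h = a} := by
    ext ω
    simp [action]
  rw [this]
  exact MeasurableSet.biUnion (Set.to_countable _) fun a _ => A.measurable_next _ _ _ _ a

theorem ProbabilisticAlgorithm.measurableSet_history (k : ℕ) (h : List (Set (Fin n))) :
    MeasurableSet {ω | (A.run ω).history I k = h} := by
  induction k generalizing h with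
  | zero => exact MeasurableSet.const ([] = h)
  | succ k ih =>
    have : {ω | (A.run ω).history I (k + 1) = h} = ⋃ h', {ω | (A.run ω).history I k = h'} ∩
        {ω | (match (A.run ω).action I h' with
          | .perform op => h' ++ [op.result I.graph]
          | .answer _ => h') = h} := by
      ext ω
      simp [history_succ]
    rw [this]
    exact MeasurableSet.iUnion fun h' => (ih h').inter (A.measurableSet_action I h' fun a =>
      (match a with
        | .perform op => h' ++ [op.result I.graph]
        | .answer _ => h') = h)

theorem ProbabilisticAlgorithm.measurableSet_outputs (b : Bool) :
    MeasurableSet {ω | (A.run ω).Outputs I b} := by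
  have : {ω | (A.run ω).Outputs I b} = ⋃ (k) (h), {ω | (A.run ω).history I k = h} ∩
      {ω | (A.run ω).action I h = .answer b} := by
    ext ω
    simp [Outputs]
  rw [this]
  exact MeasurableSet.iUnion fun k => MeasurableSet.iUnion fun h =>
    (A.measurableSet_history I k h).inter (A.measurableSet_action I h fun a => a = .answer b)

theorem ProbabilisticAlgorithm.measurableSet_correct (obj : Objective) :
    MeasurableSet {ω | (A.run ω).Correct I obj} := by
  have : {ω | (A.run ω).Correct I obj} =
      ⋃ b, {ω | (A.run ω).Outputs I b} ∩ {_ω | b = true ↔ obj.Holds I} := by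
    ext ω
    simp only [Correct, Set.mem_ofPred_eq, Set.mem_iUnion, Set.mem_inter_iff]
  rw [this]
  exact MeasurableSet.iUnion fun b => (A.measurableSet_outputs I b).inter (MeasurableSet.const _)

end Measurability

/-! ### The adversary argument. -/

/-- A base instance on which the objective fails, and alternatives on which it holds, such that
every symbolic operation distinguishes at most one alternative from the base instance. -/
structure HardFamily (obj : Objective) (ι : Type*) (n : ℕ) where
  base : Instance n
  alt : ι → Instance n
  start_eq : ∀ i, (alt i).start = base.start
  target_eq : ∀ i, (alt i).target = base.target
  subsingleton_distinguished : ∀ op : SymbolicOp (Fin n),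
    {i | op.result base.graph ≠ op.result (alt i).graph}.Subsingleton
  not_holds_base : ¬ obj.Holds base
  holds_alt : ∀ i, obj.Holds (alt i)

namespace HardFamily

variable {obj : Objective} {ι : Type*} {n : ℕ} (F : HardFamily obj ι n)

/-- The alternatives that are distinguished from the base instance in the run on the latter. -/
def detected (A : SymbolicAlgorithm) : Set ι :=
  {i | ∃ k op, A.action F.base (A.history F.base k) = .perform op ∧
    op.result F.base.graph ≠ op.result (F.alt i).graph}

/-- Sending an alternative to a step that detects it is injective, since one operation distinguishes
at most one alternative; that step is one-step because set operations ignore the graph. -/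
theorem encard_detected_le (A : SymbolicAlgorithm) :
    (F.detected A).encard ≤ A.numOneStep F.base := by
  choose! k hk using fun i (hi : i ∈ F.detected A) => hi
  refine Set.encard_le_encard_of_injOn (f := k) (fun i hi => ?_) fun i hi j hj hij => ?_
  · obtain ⟨op, hop, hne⟩ := hk i hi
    refine ⟨op, hop, ?_⟩
    cases op with
    | pre X => trivial
    | post X => trivial
    | _ => exact absurd rfl hne
  · obtain ⟨op, hop, hne⟩ := hk i hi
    obtain ⟨op', hop', hne'⟩ := hk j hj
    rw [hij, hop'] at hop
    obtain rfl := Action.perform.inj hop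
    exact F.subsingleton_distinguished op' hne hne'

/-- An algorithm that is right on the base instance and on an alternative detects the latter. -/
theorem mem_detected {A : SymbolicAlgorithm} {i : ι} (h₀ : A.Correct F.base obj)
    (h : A.Correct (F.alt i) obj) : i ∈ F.detected A := by
  by_contra hi
  obtain ⟨b, hb, hb'⟩ := h₀
  obtain ⟨c, hc, hc'⟩ := h
  -- Undetected means that both runs coincide, so they give the same answer, although the correct
  -- answers differ.
  rw [SymbolicAlgorithm.outputs_congr (F.start_eq i) (F.target_eq i)] at hc
  · obtain rfl := hb.unique hc
    exact F.not_holds_base (hb'.1 (hc'.2 (F.holds_alt i)))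
  · intro k op hop
    by_contra hne
    exact hi ⟨k, op, hop, hne⟩

variable [Fintype ι]

theorem card_le_numOneStep {A : SymbolicAlgorithm} (h₀ : A.Correct F.base obj)
    (h : ∀ i, A.Correct (F.alt i) obj) : (Fintype.card ι : ℕ∞) ≤ A.numOneStep F.base := by
  have huniv : F.detected A = Set.univ := Set.eq_univ_of_forall fun i => F.mem_detected h₀ (h i)
  simpa [huniv, Set.encard_univ] using F.encard_detected_le A

theorem card_mul_le_expectedOneStep {Ω : Type*} [MeasurableSpace Ω] {μ : Measure Ω}
    [IsProbabilityMeasure μ] {A : ProbabilisticAlgorithm Ω} {δ : ℝ} (hδ : δ < 1 / 2)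
    (h₀ : ENNReal.ofReal (1 - δ) ≤ μ {ω | (A.run ω).Correct F.base obj})
    (h : ∀ i, ENNReal.ofReal (1 - δ) ≤ μ {ω | (A.run ω).Correct (F.alt i) obj}) :
    ENNReal.ofReal ((1 - 2 * δ) * Fintype.card ι) ≤ A.expectedOneStep μ F.base := by
  classical
  set B : Set Ω := {ω | (A.run ω).Correct F.base obj}
  set C : ι → Set Ω := fun i => {ω | (A.run ω).Correct (F.alt i) obj}
  have hB : MeasurableSet B := A.measurableSet_correct F.base obj
  have hC : ∀ i, MeasurableSet (C i) := fun i => A.measurableSet_correct (F.alt i) obj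
  -- Inclusion-exclusion: two events of probability at least `1 - δ` overlap in at least `1 - 2δ`.
  have hBC : ∀ i, ENNReal.ofReal (1 - 2 * δ) ≤ μ (B ∩ C i) := by
    intro i
    have hadd := measure_union_add_inter (μ := μ) B (hC i)
    have hle : ENNReal.ofReal (1 - δ) + ENNReal.ofReal (1 - δ) ≤ 1 + μ (B ∩ C i) :=
      calc _ ≤ μ B + μ (C i) := add_le_add h₀ (h i)
        _ = μ (B ∪ C i) + μ (B ∩ C i) := hadd.symm
        _ ≤ 1 + μ (B ∩ C i) := by gcongr; exact prob_le_one
    rw [← ENNReal.ofReal_add (by linarith) (by linarith),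
      show 1 - δ + (1 - δ) = 1 + (1 - 2 * δ) by ring,
      ENNReal.ofReal_add zero_le_one (by linarith), ENNReal.ofReal_one] at hle
    exact (ENNReal.add_le_add_iff_left ENNReal.one_ne_top).1 hle
  -- For fixed `ω` the sum counts alternatives that are all detected by the run on the base
  -- instance.
  have hpoint : ∀ ω, ∑ i, (B ∩ C i).indicator (1 : Ω → ℝ≥0∞) ω ≤
      (((A.run ω).numOneStep F.base : ℕ∞) : ℝ≥0∞) := by
    intro ω
    have hsub : (↑(Finset.univ.filter fun i => ω ∈ B ∩ C i) : Set ι) ⊆ F.detected (A.run ω) := by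
      intro i hi
      have hi' : ω ∈ B ∩ C i := by simpa using hi
      exact F.mem_detected hi'.1 hi'.2
    have hcard := (Set.encard_le_encard hsub).trans (F.encard_detected_le (A.run ω))
    rw [Set.encard_coe_eq_coe_finsetCard] at hcard
    have hcast := ENat.toENNReal_le.2 hcard
    simpa [Set.indicator_apply, Finset.sum_boole] using hcast
  calc ENNReal.ofReal ((1 - 2 * δ) * Fintype.card ι)
      = ∑ _i : ι, ENNReal.ofReal (1 - 2 * δ) := by
        rw [Finset.sum_const, Finset.card_univ, mul_comm,
          ENNReal.ofReal_mul (Nat.cast_nonneg _), ENNReal.ofReal_natCast, nsmul_eq_mul]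
    _ ≤ ∑ i, μ (B ∩ C i) := Finset.sum_le_sum fun i _ => hBC i
    _ = ∑ i, ∫⁻ ω, (B ∩ C i).indicator 1 ω ∂μ :=
        Finset.sum_congr rfl fun i _ => (lintegral_indicator_one (hB.inter (hC i))).symm
    _ = ∫⁻ ω, ∑ i, (B ∩ C i).indicator 1 ω ∂μ :=
        (lintegral_finsetSum _ fun i _ => measurable_one.indicator (hB.inter (hC i))).symm
    _ ≤ A.expectedOneStep μ F.base := lintegral_mono hpoint

end HardFamily

/-! ### Linear orders with loops. -/

/-- The linear order on `Fin n` as a graph, with additional loops at the vertices of `L`, and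
edges from each vertex of `H` to all vertices. -/
def orderGraph {n : ℕ} (H L : Set (Fin n)) : Digraph (Fin n) where
  Adj u v := u < v ∨ (u = v ∧ u ∈ L) ∨ u ∈ H

section OrderGraph

variable {n : ℕ} {H L : Set (Fin n)}

theorem orderGraph_adj {u v : Fin n} :
    (orderGraph H L).Adj u v ↔ u < v ∨ (u = v ∧ u ∈ L) ∨ u ∈ H := Iff.rfl

theorem orderGraph_mono {L' : Set (Fin n)} (h : L ⊆ L') {u v : Fin n}
    (huv : (orderGraph H L).Adj u v) : (orderGraph H L').Adj u v :=
  huv.imp_right (Or.imp_left (And.imp_right (@h u)))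

/-- `Pre` only detects a loop at the largest vertex of its argument. -/
theorem isGreatest_of_pre_ne {S : Set (Fin n)} {i : Fin n}
    (h : pre (orderGraph H ∅) S ≠ pre (orderGraph H {i}) S) : IsGreatest S i := by
  -- A loop can only enlarge `Pre`, so some `v` is gained. It has no loopless edge into `S`, so it
  -- is gained through the loop and nothing in `S` lies above it.
  obtain ⟨v, ⟨s, hs, hvs⟩, hv⟩ : ∃ v ∈ pre (orderGraph H {i}) S, v ∉ pre (orderGraph H ∅) S := by
    by_contra! hsub
    exact h (Set.Subset.antisymm
      (fun v ⟨s, hs, hvs⟩ => ⟨s, hs, orderGraph_mono (Set.empty_subset _) hvs⟩) hsub)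
  have hno : ∀ w ∈ S, ¬ (v < w ∨ v ∈ H) := fun w hw hvw =>
    hv ⟨w, hw, hvw.imp_right Or.inr⟩
  obtain hlt | ⟨rfl, rfl⟩ | hH := hvs
  · exact absurd (Or.inl hlt) (hno s hs)
  · exact ⟨hs, fun w hw => not_lt.1 fun hlt => hno w hw (Or.inl hlt)⟩
  · exact absurd (Or.inr hH) (hno s hs)

/-- `Post` only detects a loop at the smallest vertex of its argument. -/
theorem isLeast_of_post_ne {S : Set (Fin n)} {i : Fin n}
    (h : post (orderGraph H ∅) S ≠ post (orderGraph H {i}) S) : IsLeast S i := by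
  obtain ⟨v, ⟨s, hs, hsv⟩, hv⟩ : ∃ v ∈ post (orderGraph H {i}) S,
      v ∉ post (orderGraph H ∅) S := by
    by_contra! hsub
    exact h (Set.Subset.antisymm
      (fun v ⟨s, hs, hsv⟩ => ⟨s, hs, orderGraph_mono (Set.empty_subset _) hsv⟩) hsub)
  have hno : ∀ w ∈ S, ¬ (w < v ∨ w ∈ H) := fun w hw hwv =>
    hv ⟨w, hw, hwv.imp_right Or.inr⟩
  obtain hlt | ⟨rfl, rfl⟩ | hH := hsv
  · exact absurd (Or.inl hlt) (hno s hs)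
  · exact ⟨hs, fun w hw => not_lt.1 fun hlt => hno w hw (Or.inl hlt)⟩
  · exact absurd (Or.inr hH) (hno s hs)

theorem subsingleton_orderGraph_result_ne (op : SymbolicOp (Fin n)) :
    {i | op.result (orderGraph H ∅) ≠ op.result (orderGraph H {i})}.Subsingleton := by
  intro i hi j hj
  cases op with
  | pre X => exact (isGreatest_of_pre_ne hi).unique (isGreatest_of_pre_ne hj)
  | post X => exact (isLeast_of_post_ne hi).unique (isLeast_of_post_ne hj)
  | _ => exact absurd rfl hi

/-- The graph `orderGraph H L` with start vertex `0` and all vertices outside `H` as targets. -/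
def orderInstance [NeZero n] (H L : Set (Fin n)) : Instance n where
  graph := orderGraph H L
  start := 0
  target := Hᶜ

theorem Objective.SatisfiedBy.eventually {V : Type*} {obj : Objective} {T : Set V} {p : ℕ → V}
    (h : obj.SatisfiedBy T p) : ∀ᶠ i in atTop, p i ∈ T := by
  cases obj with
  | safety => exact Eventually.of_forall h
  | coLiveness => exact h

theorem Objective.satisfiedBy_of_forall {V : Type*} (obj : Objective) {T : Set V} {p : ℕ → V}
    (h : ∀ i, p i ∈ T) : obj.SatisfiedBy T p := by
  cases obj with
  | safety => exact h
  | coLiveness => exact Eventually.of_forall h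

theorem not_holds_orderInstance [NeZero n] (obj : Objective) (H : Set (Fin n)) :
    ¬ obj.Holds (orderInstance H ∅) := by
  rintro ⟨p, ⟨-, hp⟩, hT⟩
  obtain ⟨m, hm⟩ := eventually_atTop.1 hT.eventually
  -- Once the path stays outside `H`, only order edges remain, so it would increase forever in a
  -- finite order.
  have hmono : StrictMono fun k => p (m + k) := by
    refine strictMono_nat_of_lt_succ fun k => ?_
    obtain h | ⟨-, h⟩ | h := hp (m + k)
    · exact h
    · exact absurd h (Set.notMem_empty _)
    · exact absurd h (hm (m + k) (Nat.le_add_right _ _))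
  exact not_injective_infinite_finite _ hmono.injective

theorem holds_orderInstance [NeZero n] (obj : Objective) (h0 : 0 ∉ H) {i : Fin n} (hi : i ∉ H) :
    obj.Holds (orderInstance H {i}) := by
  refine ⟨fun k => if k = 0 then 0 else i, ⟨rfl, fun k => ?_⟩,
    obj.satisfiedBy_of_forall fun k => ?_⟩
  · rcases eq_or_ne i 0 with rfl | hne
    · simp [orderInstance, orderGraph_adj]
    · rcases eq_or_ne k 0 with rfl | hk
      · simp [orderInstance, orderGraph_adj, Fin.pos_iff_ne_zero.2 hne]
      · simp [orderInstance, orderGraph_adj, hk]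
  · split_ifs
    · exact h0
    · exact hi

/-- The instances without loops and with a single loop outside `H` are hard to tell apart. -/
def orderFamily [NeZero n] (obj : Objective) (H : Set (Fin n)) (h0 : 0 ∉ H) :
    HardFamily obj {i // i ∉ H} n where
  base := orderInstance H ∅
  alt i := orderInstance H {i.1}
  start_eq _ := rfl
  target_eq _ := rfl
  subsingleton_distinguished op _ hi _ hj :=
    Subtype.ext (subsingleton_orderGraph_result_ne op hi hj)
  not_holds_base := not_holds_orderInstance obj H
  holds_alt i := holds_orderInstance obj h0 i.2

/-- Walks never descend, so a reachable vertex is equal to the source or one edge away; the edge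
from 0 to 1 attains distance 1. -/
theorem diameter_orderGraph_empty (hn : 2 ≤ n) (L : Set (Fin n)) :
    diameter (orderGraph ∅ L) = 1 := by
  refine le_antisymm (diameter_le fun u v ⟨k, p, hu, hv, hp⟩ => ?_) ?_
  · have hmono : ∀ j ≤ k, u ≤ p j := by
      intro j
      induction j with
      | zero => exact fun _ => hu.ge
      | succ j ih =>
        intro hj
        refine (ih (by omega)).trans ?_
        obtain h | ⟨h, -⟩ | h := hp j (by omega)
        · exact h.le
        · exact h.le
        · exact absurd h (Set.notMem_empty _)
    rcases (hv ▸ hmono k le_rfl : u ≤ v).eq_or_lt with rfl | hlt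
    · exact (HasWalk.refl _ u).dist_le.trans (by simp)
    · exact (HasWalk.of_adj (orderGraph_adj.2 (Or.inl hlt))).dist_le
  · have hadj : (orderGraph ∅ L).Adj (⟨0, by omega⟩ : Fin n) ⟨1, by omega⟩ :=
      Or.inl (Fin.mk_lt_mk.2 Nat.zero_lt_one)
    refine le_diameter (HasWalk.of_adj hadj) fun j ⟨p, hu, hv, _⟩ => ?_
    rcases Nat.eq_zero_or_pos j with rfl | hj
    · simp [hu] at hv
    · exact_mod_cast hj

end OrderGraph

/-! ### The last vertex as a hub. -/

section Hub

variable {m : ℕ} {L : Set (Fin (m + 1))}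

theorem orderGraph_adj_last (u : Fin (m + 1)) :
    (orderGraph {Fin.last m} L).Adj u (Fin.last m) := by
  rcases (Fin.le_last u).lt_or_eq with h | h
  · exact Or.inl h
  · exact Or.inr (Or.inr h)

theorem orderGraph_last_adj (v : Fin (m + 1)) :
    (orderGraph {Fin.last m} L).Adj (Fin.last m) v :=
  Or.inr (Or.inr rfl)

theorem diameter_orderGraph_last (hm : 2 ≤ m) (L : Set (Fin (m + 1))) :
    diameter (orderGraph {Fin.last m} L) = 2 := by
  refine le_antisymm
    (diameter_le_two_of_hub _ orderGraph_adj_last orderGraph_last_adj) ?_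
  -- Only the hub has descending edges, and vertex 1 is not the hub because `2 ≤ m`; so 1 reaches 0
  -- in no fewer than two steps.
  refine le_diameter (u := ⟨1, by omega⟩) (v := ⟨0, by omega⟩)
    (HasWalk.of_adj_adj (orderGraph_adj_last _) (orderGraph_last_adj _))
    fun j ⟨p, hu, hv, hp⟩ => ?_
  obtain rfl | rfl | hj : j = 0 ∨ j = 1 ∨ 2 ≤ j := by omega
  · simp [hu] at hv
  · have h := hp 0 Nat.zero_lt_one
    rw [hu, hv, orderGraph_adj] at h
    simp [Fin.ext_iff] at h
    omega
  · exact_mod_cast hj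

end Hub

/-! ### Linear lower bounds for the two graph classes. -/

/-- Both kinds of algorithms need linearly many one-step operations on graphs of diameter one, even
if all vertices are targets. -/
theorem exists_diameter_one_cost (obj : Objective) {δ : ℝ} (hδ₀ : 0 ≤ δ) (hδ : δ < 1 / 2) {n : ℕ}
    (hn : 2 ≤ n) : ∃ I : Instance n, diameter I.graph = 1 ∧ I.target = Set.univ ∧
      (∀ A : SymbolicAlgorithm, A.Solves obj (fun _ G => diameter G = 1) →
        ENNReal.ofReal ((1 - 2 * δ) * n) ≤ ((A.numOneStep I : ℕ∞) : ℝ≥0∞)) ∧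
      ∀ (Ω : Type*) [MeasurableSpace Ω] (μ : Measure Ω) [IsProbabilityMeasure μ]
        (A : ProbabilisticAlgorithm Ω), A.Solves μ obj δ (fun _ G => diameter G = 1) →
        ENNReal.ofReal ((1 - 2 * δ) * n) ≤ A.expectedOneStep μ I := by
  have : NeZero n := ⟨by omega⟩
  have hdiam : ∀ L : Set (Fin n), diameter (orderInstance ∅ L).graph = 1 :=
    diameter_orderGraph_empty hn
  let F := orderFamily (n := n) obj ∅ (Set.notMem_empty _)
  classical
  have hcard : Fintype.card {i : Fin n // i ∉ (∅ : Set (Fin n))} = n := by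
    simp
  refine ⟨F.base, hdiam _, Set.compl_empty, fun A hA => ?_, fun Ω _ μ _ A hA => ?_⟩
  · have h := F.card_le_numOneStep (hA n _ (hdiam _)) fun i => hA n _ (hdiam _)
    rw [hcard] at h
    calc ENNReal.ofReal ((1 - 2 * δ) * n) ≤ ENNReal.ofReal n :=
          ENNReal.ofReal_le_ofReal (mul_le_of_le_one_left (Nat.cast_nonneg _) (by linarith))
      _ = ((n : ℕ∞) : ℝ≥0∞) := by simp
      _ ≤ _ := ENat.toENNReal_le.2 h
  · have h := F.card_mul_le_expectedOneStep hδ (hA n _ (hdiam _)) fun i => hA n _ (hdiam _)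
    rwa [hcard] at h

/-- Both kinds of algorithms need linearly many one-step operations on strongly connected graphs of
diameter two. -/
theorem exists_diameter_two_cost (obj : Objective) {δ : ℝ} (hδ : δ < 1 / 2) {m : ℕ}
    (hm : 2 ≤ m) : ∃ I : Instance (m + 1), StronglyConnected I.graph ∧ diameter I.graph = 2 ∧
      sumSccDiameters I.graph ≤ 3 ∧
      (∀ A : SymbolicAlgorithm,
        A.Solves obj (fun _ G => StronglyConnected G ∧ diameter G = 2) →
        (m : ℕ∞) ≤ A.numOneStep I) ∧
      ∀ (Ω : Type*) [MeasurableSpace Ω] (μ : Measure Ω) [IsProbabilityMeasure μ]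
        (A : ProbabilisticAlgorithm Ω),
        A.Solves μ obj δ (fun _ G => StronglyConnected G ∧ diameter G = 2) →
        ENNReal.ofReal ((1 - 2 * δ) * m) ≤ A.expectedOneStep μ I := by
  have hclass : ∀ L : Set (Fin (m + 1)),
      StronglyConnected (orderInstance {Fin.last m} L).graph ∧
        diameter (orderInstance {Fin.last m} L).graph = 2 := fun L =>
    ⟨stronglyConnected_of_hub _ orderGraph_adj_last orderGraph_last_adj,
      diameter_orderGraph_last hm L⟩
  -- The hub is excluded as a loop position, which leaves `m` alternatives.
  let F := orderFamily (n := m + 1) obj {Fin.last m} (by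
    simp only [Set.mem_singleton_iff, Fin.ext_iff, Fin.val_zero, Fin.val_last]
    omega)
  classical
  have hcard : Fintype.card {i : Fin (m + 1) // i ∉ ({Fin.last m} : Set (Fin (m + 1)))} = m := by
    simp [Fintype.card_subtype_compl]
  refine ⟨F.base, (hclass _).1, (hclass _).2,
    sumSccDiameters_le_three_of_hub _ orderGraph_adj_last orderGraph_last_adj,
    fun A hA => ?_, fun Ω _ μ _ A hA => ?_⟩
  · have h := F.card_le_numOneStep (hA _ _ (hclass _)) fun i => hA _ _ (hclass _)
    rwa [hcard] at h
  · have h := F.card_mul_le_expectedOneStep hδ (hA _ _ (hclass _)) fun i => hA _ _ (hclass _)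
    rwa [hcard] at h

end SymbolicGraph


theorem theorem3p5 (obj : SymbolicGraph.Objective) (δ : ℝ) (hδ₀ : 0 ≤ δ) (hδ : δ < 1 / 2) :
    -- (1) `Ω(n)`, even for graphs of diameter 1
    (∃ c : ℝ, 0 < c ∧ ∃ N : ℕ, ∀ n : ℕ, N ≤ n →
      (∀ A : SymbolicGraph.SymbolicAlgorithm,
        A.Solves obj (fun _ G => SymbolicGraph.diameter G = 1) →
        ∃ I : SymbolicGraph.Instance n, SymbolicGraph.diameter I.graph = 1 ∧
          ENNReal.ofReal (c * n) ≤ ((A.numOneStep I : ℕ∞) : ℝ≥0∞)) ∧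
      (∀ (Ω : Type*) [MeasurableSpace Ω] (μ : Measure Ω) [IsProbabilityMeasure μ]
        (A : SymbolicGraph.ProbabilisticAlgorithm Ω),
        A.Solves μ obj δ (fun _ G => SymbolicGraph.diameter G = 1) →
        ∃ I : SymbolicGraph.Instance n, SymbolicGraph.diameter I.graph = 1 ∧
          ENNReal.ofReal (c * n) ≤ A.expectedOneStep μ I)) ∧
    -- (2) `Ω(|T|)`, even for graphs of diameter 1
    (∃ c : ℝ, 0 < c ∧ ∃ N : ℕ, ∀ t : ℕ, N ≤ t →
      (∀ A : SymbolicGraph.SymbolicAlgorithm,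
        A.Solves obj (fun _ G => SymbolicGraph.diameter G = 1) →
        ∃ (n : ℕ) (I : SymbolicGraph.Instance n), SymbolicGraph.diameter I.graph = 1 ∧
          I.target.ncard = t ∧
          ENNReal.ofReal (c * t) ≤ ((A.numOneStep I : ℕ∞) : ℝ≥0∞)) ∧
      (∀ (Ω : Type*) [MeasurableSpace Ω] (μ : Measure Ω) [IsProbabilityMeasure μ]
        (A : SymbolicGraph.ProbabilisticAlgorithm Ω),
        A.Solves μ obj δ (fun _ G => SymbolicGraph.diameter G = 1) →
        ∃ (n : ℕ) (I : SymbolicGraph.Instance n), SymbolicGraph.diameter I.graph = 1 ∧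
          I.target.ncard = t ∧
          ENNReal.ofReal (c * t) ≤ A.expectedOneStep μ I)) ∧
    -- (3) `ω(∑_C (D_C + 1))`, even for strongly connected graphs of diameter 2
    (∀ K : ℕ, ∃ N : ℕ, ∀ n : ℕ, N ≤ n →
      (∀ A : SymbolicGraph.SymbolicAlgorithm,
        A.Solves obj (fun _ G => SymbolicGraph.StronglyConnected G ∧
          SymbolicGraph.diameter G = 2) →
        ∃ I : SymbolicGraph.Instance n, SymbolicGraph.StronglyConnected I.graph ∧
          SymbolicGraph.diameter I.graph = 2 ∧
          K * SymbolicGraph.sumSccDiameters I.graph < A.numOneStep I) ∧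
      (∀ (Ω : Type*) [MeasurableSpace Ω] (μ : Measure Ω) [IsProbabilityMeasure μ]
        (A : SymbolicGraph.ProbabilisticAlgorithm Ω),
        A.Solves μ obj δ (fun _ G => SymbolicGraph.StronglyConnected G ∧
          SymbolicGraph.diameter G = 2) →
        ∃ I : SymbolicGraph.Instance n, SymbolicGraph.StronglyConnected I.graph ∧
          SymbolicGraph.diameter I.graph = 2 ∧
          K * ((SymbolicGraph.sumSccDiameters I.graph : ℕ∞) : ℝ≥0∞) <
            A.expectedOneStep μ I)) := by
  have hc : 0 < 1 - 2 * δ := by linarith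
  refine ⟨⟨1 - 2 * δ, hc, 2, fun n hn => ⟨fun A hA => ?_, fun Ω _ μ _ A hA => ?_⟩⟩,
    ⟨1 - 2 * δ, hc, 2, fun n hn => ⟨fun A hA => ?_, fun Ω _ μ _ A hA => ?_⟩⟩, fun K => ?_⟩
  · obtain ⟨I, hI, -, h, -⟩ := SymbolicGraph.exists_diameter_one_cost.{0} obj hδ₀ hδ hn
    exact ⟨I, hI, h A hA⟩
  · obtain ⟨I, hI, -, -, h⟩ := SymbolicGraph.exists_diameter_one_cost obj hδ₀ hδ hn
    exact ⟨I, hI, h Ω μ A hA⟩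
  · obtain ⟨I, hI, hT, h, -⟩ := SymbolicGraph.exists_diameter_one_cost.{0} obj hδ₀ hδ hn
    exact ⟨n, I, hI, by simp [hT, Set.ncard_univ], h A hA⟩
  · obtain ⟨I, hI, hT, -, h⟩ := SymbolicGraph.exists_diameter_one_cost obj hδ₀ hδ hn
    exact ⟨n, I, hI, by simp [hT, Set.ncard_univ], h Ω μ A hA⟩
  · obtain ⟨M, hM⟩ := exists_nat_gt (3 * K / (1 - 2 * δ))
    rw [div_lt_iff₀ hc] at hM
    refine ⟨M + 3, fun n hn => ?_⟩
    obtain ⟨m, rfl⟩ : ∃ m, n = m + 1 := ⟨n - 1, by omega⟩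
    have hMm : (M : ℝ) ≤ m := by exact_mod_cast (by omega : M ≤ m)
    have hlt : ((K * 3 : ℕ) : ℝ) < (1 - 2 * δ) * m := by
      push_cast
      nlinarith [mul_le_mul_of_nonneg_right hMm hc.le]
    refine ⟨fun A hA => ?_, fun Ω _ μ _ A hA => ?_⟩
    · obtain ⟨I, hI, hd, hs, h, -⟩ :=
        SymbolicGraph.exists_diameter_two_cost.{0} (m := m) obj hδ (by omega)
      refine ⟨I, hI, hd, ?_⟩
      have hKm : K * 3 < m := by
        have : ((K * 3 : ℕ) : ℝ) < m :=
          hlt.trans_le (mul_le_of_le_one_left (Nat.cast_nonneg _) (by linarith))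
        exact_mod_cast this
      calc (K : ℕ∞) * SymbolicGraph.sumSccDiameters I.graph ≤ K * 3 := by gcongr
        _ < m := by exact_mod_cast hKm
        _ ≤ _ := h A hA
    · obtain ⟨I, hI, hd, hs, -, h⟩ :=
        SymbolicGraph.exists_diameter_two_cost (m := m) obj hδ (by omega)
      refine ⟨I, hI, hd, ?_⟩
      have hs' : ((SymbolicGraph.sumSccDiameters I.graph : ℕ∞) : ℝ≥0∞) ≤ 3 := by
        simpa using ENat.toENNReal_le.2 hs
      calc (K : ℝ≥0∞) * ((SymbolicGraph.sumSccDiameters I.graph : ℕ∞) : ℝ≥0∞) ≤ K * 3 := by gcongr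
        _ = ENNReal.ofReal ((K * 3 : ℕ) : ℝ) := by rw [ENNReal.ofReal_natCast]; push_cast; rfl
        _ < ENNReal.ofReal ((1 - 2 * δ) * m) :=
            (ENNReal.ofReal_lt_ofReal_iff_of_nonneg (Nat.cast_nonneg _)).2 hlt
        _ ≤ _ := h Ω μ A hA
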